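/- **Setting.** Let $M\in GL(2,\mathbb Z)$ be primitive (some power has no zero entry), with expanding eigenvalue $\lambda>1$ and contracting eigenvalue $\tilde\lambda=\det(M)/\lambda$. Let $V,W\subset\mathbb R^2$ be the corresponding eigenlines, $V$ identified with $\mathbb R$ by the choice of an eigenvector, and let $Y$ be the vertical axis, identified with $\mathbb R$. Let $\Pi_V$ be the projection onto $V$ parallel to $W$ and $\Pi_Y$ the projection onto $Y$ parallel to $V$. Let $l\in\mathbb Q^2$ with $\Pi_Y(l)>0$. For $t\in\mathbb R^2$ the window $\Omega_{l,t}$ is the interval from $\Pi_Y(t)$ to $\Pi_Y(t)+\Pi_Y(l)$, half-open on either side, and the interval projection tiling with this window has vertex set $\Pi_V(\mathbb Z^2\cap(V+\Omega_{l,t}))$. A substitution rule $\sigma$ inflates labelled tiles about the origin by the factor $\lambda$ and replaces each inflated prototile, according to its label, by a fixed finite sequence of prototiles that covers it exactly; the set of labelled prototiles is finite. It is a substitution rule with interval projection structure and data $M,s,l$, where $s\in\mathbb Q^2$, if the tiles of all these tilings are labelled according to the position in the window of the lattice point giving their left vertex and, for every $t$ and either orientation, the subwindow $\overline\Omega_{l,t,s}=\Pi_Y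 M\,\Omega_{l,0}+\Pi_Y(s+t)$, half-open on the same side as $\Omega_{l,t}$, is contained in $\Omega_{l,t}$, and $\sigma$ maps the tiling whose inflation has window $\overline\Omega_{l,t,s}$ to the tiling with window $\Omega_{l,t}$. Below, tilings are the unlabelled interval projection tilings above. **Theorem.** Let $\sigma$ be a substitution rule with interval projection structure and data $M,s,l$. (a) *Line.* The number, up to translation, of tilings of the line that $\sigma$ maps to a translate of themselves is finite and equals * $|\det(M-I)|$ if $s\notin \mathbb Z^2\cup(\mathbb Z^2-(M-I)l)$; * $|\det(M-I)|+1$ if $\det M=1$, and $|\det(M-I)|-1$ if $\det M=-1$, when $s\in\mathbb Z^2\cup(\mathbb Z^2-(M-I)l)$, except in the following case; * $|\det(M-I)|+2$ if $\det M=1$, and $|\det(M-I)|-2$ if $\det M=-1$, when $s\in\mathbb Z^2\cap(\mathbb Z^2-(M-I)l)$ and $l\notin\mathbb Z^2$. (b) *Half-line.* Let $J=\big[\tfrac{\Pi_Y(s)}{\tilde\lambda-1},\tfrac{\Pi_Y(s)}{\tilde\lambda-1}+\Pi_Y(l)\big]$ be the invariant window interval. Call it singular if an end point of $J$ lies in $\Pi_Y(\mathbb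 Z^2)$; the points of $\mathbb Z^2$ that project to an end point of $J$ are then called singular. Then $0\in J$, and $J$ is singular if and only if $s\in(M-I)\mathbb Z^2\cup(M-I)(\mathbb Z^2-l)$. Consider the tilings of $[0,\infty)$ with boundary vertex $0$ that are restrictions of the tilings above. The number of those that $\sigma$ maps to themselves is finite and equals * $1$ if $J$ is non-singular; * $1$ if $0$ is an end point of $J$, which happens only for $\det M=1$; * if $J$ is singular and $0$ is in its interior: $2$ for $\det M=1$ and $0$ for $\det M=-1$ when some singular lattice point projects along $W$ to the positive half of $V$; and $1$ when all singular lattice points project to the negative half of $V$. -/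

import Mathlib

open Set

noncomputable section

/-- A matrix `M ∈ GL(2, ℤ)`, primitive (some power has no zero entry), with expanding eigenvalue
`lam > 1` and contracting eigenvalue `det M / lam`.  The tiled line `V` is spanned by the
expanding eigenvector `v` (which also fixes the coordinate on `V`), the line `W` is spanned by
the contracting eigenvector `w`. -/
structure ProjectionStructure where
  M : Matrix (Fin 2) (Fin 2) ℤ
  isUnit_det : IsUnit M.det
  primitive : ∃ n : ℕ, ∀ i j, (M ^ n) i j ≠ 0
  lam : ℝ
  one_lt_lam : 1 < lam
  v : Fin 2 → ℝ
  v_ne_zero : v ≠ 0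
  mulVec_v : (M.map (Int.cast : ℤ → ℝ)).mulVec v = lam • v
  w : Fin 2 → ℝ
  w_ne_zero : w ≠ 0
  mulVec_w : (M.map (Int.cast : ℤ → ℝ)).mulVec w = ((M.det : ℝ) / lam) • w

/-- The inclusion `ℤ² ⊆ ℝ²`. -/
def ofInt (z : Fin 2 → ℤ) : Fin 2 → ℝ := fun i => (z i : ℝ)

/-- The inclusion `ℚ² ⊆ ℝ²`. -/
def ofRat (u : Fin 2 → ℚ) : Fin 2 → ℝ := fun i => (u i : ℝ)

/-- The side on which a half-open window contains its end point. -/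
inductive Side
  | left
  | right

/-- The opposite side. -/
def Side.flip : Side → Side
  | .left => .right
  | .right => .left

namespace ProjectionStructure

variable (P : ProjectionStructure)

/-- The contracting eigenvalue. -/
def mu : ℝ := (P.M.det : ℝ) / P.lam

/-- The linear map of `ℝ²` given by `M`. -/
def act (u : Fin 2 → ℝ) : Fin 2 → ℝ := (P.M.map (Int.cast : ℤ → ℝ)).mulVec u

/-- The projection of `u` parallel to `V` onto the vertical axis `Y`, as a real number. -/
def projY (u : Fin 2 → ℝ) : ℝ := (P.v 0 * u 1 - P.v 1 * u 0) / P.v 0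

/-- The projection of `u` parallel to `W` onto `V`, as the coefficient of `v`. -/
def projV (u : Fin 2 → ℝ) : ℝ :=
  (u 0 * P.w 1 - u 1 * P.w 0) / (P.v 0 * P.w 1 - P.v 1 * P.w 0)

/-- The half-open window with base `t` and window vector `l`. -/
def window (l : Fin 2 → ℝ) : Side → (Fin 2 → ℝ) → Set ℝ
  | .left, t => Ico (P.projY t) (P.projY t + P.projY l)
  | .right, t => Ioc (P.projY t) (P.projY t + P.projY l)

/-- The map of `Y` induced by `M`: apply `M` to a point of `Y`, then project to `Y`. -/
def actY (y : ℝ) : ℝ := P.projY (P.act ![0, y])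

/-- The subwindow `Π_Y M Ω_{l,0} + Π_Y (s + t)` of the window `Ω_{l,t}`, half open on the same
side as `Ω_{l,t}` (`M` reverses the orientation of `Y` when its determinant is `-1`). -/
def subwindow (l s : Fin 2 → ℝ) (o : Side) (t : Fin 2 → ℝ) : Set ℝ :=
  (fun y => P.actY y + P.projY (s + t)) ''
    P.window l (if P.M.det = 1 then o else o.flip) 0

end ProjectionStructure

/-- A substitution rule on a set `A` of labelled prototiles: the prototile `a` is an interval of
length `length a`; after inflation by `factor` it is exactly covered by the tiles `replace a`,
laid out from left to right. -/
structure SubstitutionRule (A : Type*) where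
  factor : ℝ
  one_lt_factor : 1 < factor
  length : A → ℝ
  length_pos : ∀ a, 0 < length a
  replace : A → List A
  covers : ∀ a, ((replace a).map length).sum = factor * length a

namespace SubstitutionRule

variable {A : Type*} (σ : SubstitutionRule A)

/-- A set of placed tiles, `(x, a)` being the copy of the prototile `a` with left end `x`, is a
tiling of the line: the tiles cover it and overlap only in end points. -/
def IsTiling (X : Set (ℝ × A)) : Prop :=
  (⋃ T ∈ X, Icc T.1 (T.1 + σ.length T.2)) = univ ∧
  X.Pairwise fun T T' =>
    Disjoint (Ioo T.1 (T.1 + σ.length T.2)) (Ioo T'.1 (T'.1 + σ.length T'.2))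

/-- Inflate every tile by the factor (about the origin), then replace it. -/
def subst (X : Set (ℝ × A)) : Set (ℝ × A) :=
  {T | ∃ x a, (x, a) ∈ X ∧ ∃ i : Fin (σ.replace a).length,
    T = (σ.factor * x + (((σ.replace a).take i).map σ.length).sum, (σ.replace a).get i)}

end SubstitutionRule

/-- The vertices (left end points of tiles) of a tiling of the line or of `[0, ∞)`.  They
determine the unlabelled tiling. -/
def vert {A : Type*} (X : Set (ℝ × A)) : Set ℝ := Prod.fst '' X

/-- The part of a labelled tiling lying in `[0, ∞)`, used when `0` is a vertex. -/
def halfLine {A : Type*} (X : Set (ℝ × A)) : Set (ℝ × A) := {T ∈ X | 0 ≤ T.1}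

/-- Equivalence of unlabelled tilings up to translation. -/
def translationSetoid : Setoid (Set ℝ) where
  r S T := ∃ c : ℝ, T = (fun x => x + c) '' S
  iseqv :=
    { refl := fun S => ⟨0, by simp⟩
      symm := by
        rintro S T ⟨c, rfl⟩
        exact ⟨-c, by rw [image_image]; simp only [add_neg_cancel_right, image_id']⟩
      trans := by
        rintro S T U ⟨c, rfl⟩ ⟨d, rfl⟩
        exact ⟨c + d, by rw [image_image]; simp only [add_assoc]⟩ }

namespace ProjectionStructure

variable (P : ProjectionStructure)

/-- The interval projection tiling with window `Ω_{l,t}` (half open on side `o`), with labels: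
the tile whose left vertex comes from the lattice point `z` is labelled according to the
position of `z` relative to the window. Its vertices are `Π_V (ℤ² ∩ (V + Ω_{l,t}))`. -/
def tiling {A : Type*} (lab : Side → ℝ → A) (l : Fin 2 → ℝ) (o : Side) (t : Fin 2 → ℝ) :
    Set (ℝ × A) :=
  {T | ∃ z : Fin 2 → ℤ, P.projY (ofInt z) ∈ P.window l o t ∧
    T = (P.projV (ofInt z), lab o (P.projY (ofInt z) - P.projY t))}

/-- `σ` is a substitution rule for the interval projection tilings with window vector `l`,
labelled by `lab`, with subwindow translation `s`. -/
structure IsSubstitutionRule {A : Type*} (σ : SubstitutionRule A) (lab : Side → ℝ → A)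
    (s l : Fin 2 → ℝ) : Prop where
  factor_eq : σ.factor = P.lam
  isTiling : ∀ o t, σ.IsTiling (P.tiling lab l o t)
  subwindow_subset : ∀ o t, P.subwindow l s o t ⊆ P.window l o t
  /-- If the inflation of the tiling with window `Ω_{l,t'}` has the subwindow of `Ω_{l,t}` as
  its window, then `σ` maps the former tiling to the tiling with window `Ω_{l,t}`. -/
  subst_eq : ∀ o t o' t', P.actY '' P.window l o' t' = P.subwindow l s o t →
    σ.subst (P.tiling lab l o' t') = P.tiling lab l o t

/-- The unlabelled interval projection tilings of the line that `σ` maps to a translate of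
themselves. -/
def fixedTilings {A : Type*} (σ : SubstitutionRule A) (lab : Side → ℝ → A)
    (l : Fin 2 → ℝ) : Set (Set ℝ) :=
  {T | ∃ o t, vert (P.tiling lab l o t) = T ∧
    ∃ c : ℝ, vert (σ.subst (P.tiling lab l o t)) = (fun x => x + c) '' T}

/-- The same up to translation. -/
def fixedClasses {A : Type*} (σ : SubstitutionRule A) (lab : Side → ℝ → A)
    (l : Fin 2 → ℝ) : Set (Quotient translationSetoid) :=
  Quotient.mk translationSetoid '' P.fixedTilings σ lab l

/-- The unlabelled interval projection tilings of `[0, ∞)`, with boundary vertex `0`, that `σ`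
maps to themselves. -/
def fixedHalfTilings {A : Type*} (σ : SubstitutionRule A) (lab : Side → ℝ → A)
    (l : Fin 2 → ℝ) : Set (Set ℝ) :=
  {H | ∃ o t, 0 ∈ vert (P.tiling lab l o t) ∧ vert (halfLine (P.tiling lab l o t)) = H ∧
    vert (σ.subst (halfLine (P.tiling lab l o t))) = H}

/-- The left end of the invariant window interval. -/
def iwiLeft (s : Fin 2 → ℝ) : ℝ := P.projY s / (P.mu - 1)

/-- The right end of the invariant window interval. -/
def iwiRight (s l : Fin 2 → ℝ) : ℝ := P.projY s / (P.mu - 1) + P.projY l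

/-- The lattice point `z` projects to an end point of the invariant window interval. -/
def SingularPoint (s l : Fin 2 → ℝ) (z : Fin 2 → ℤ) : Prop :=
  P.projY (ofInt z) = P.iwiLeft s ∨ P.projY (ofInt z) = P.iwiRight s l

/-- The invariant window interval is singular. -/
def IWISingular (s l : Fin 2 → ℝ) : Prop := ∃ z, P.SingularPoint s l z

/-- The matrix `M - I`, with rational entries. -/
def matSub : Matrix (Fin 2) (Fin 2) ℚ := (P.M - 1).map (Int.cast : ℤ → ℚ)

/-! The projections are well defined. -/

theorem v_zero_ne_zero : P.v 0 ≠ 0 := by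
  intro h0
  have h1 : P.v 1 ≠ 0 := by
    intro h1
    apply P.v_ne_zero
    funext i
    fin_cases i <;> simp [h0, h1]
  have e0 := congrFun P.mulVec_v 0
  have e1 := congrFun P.mulVec_v 1
  simp [Matrix.mulVec, dotProduct, Fin.sum_univ_two, h0, h1] at e0 e1
  have hd := P.isUnit_det
  rw [Matrix.det_fin_two, e0, zero_mul, sub_zero] at hd
  have h2 := isUnit_of_mul_isUnit_right hd
  have hl := P.one_lt_lam
  rcases Int.isUnit_iff.1 h2 with h | h <;> rw [h] at e1 <;> norm_num at e1 <;> linarith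

theorem mu_lt_one : P.mu < 1 := by
  have hl := P.one_lt_lam
  unfold mu
  rw [div_lt_one (by linarith)]
  rcases Int.isUnit_iff.1 P.isUnit_det with h | h <;> rw [h] <;> push_cast <;> linarith

theorem cross_ne_zero : P.v 0 * P.w 1 - P.v 1 * P.w 0 ≠ 0 := by
  intro h
  have hv := P.v_zero_ne_zero
  have hw : P.w = (P.w 0 / P.v 0) • P.v := by
    funext i
    fin_cases i
    · simp [hv]
    · simp only [Fin.mk_one, Pi.smul_apply, smul_eq_mul]
      field_simp
      linarith
  have h1 := P.mulVec_w
  have hw0 : P.w 0 ≠ 0 := by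
    intro h0
    apply P.w_ne_zero
    rw [hw, h0]
    simp
  rw [hw, Matrix.mulVec_smul, P.mulVec_v] at h1
  have h2 := congrFun h1 0
  simp only [Pi.smul_apply, smul_eq_mul, div_mul_cancel₀ _ hv] at h2
  have h3 : P.w 0 * (P.lam - P.mu) = 0 := by
    have h4 : P.w 0 / P.v 0 * (P.lam * P.v 0) = P.w 0 * P.lam := by field_simp
    rw [h4] at h2
    unfold mu
    linarith
  have h5 := P.mu_lt_one
  have h6 := P.one_lt_lam
  rcases mul_eq_zero.1 h3 with h | h
  · exact hw0 h
  · linarith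

/-- `u - (0, projY u)` lies on `V`. -/
theorem projY_spec (u : Fin 2 → ℝ) : ∃ r : ℝ, u = ![0, P.projY u] + r • P.v := by
  have hv := P.v_zero_ne_zero
  refine ⟨u 0 / P.v 0, ?_⟩
  funext i
  fin_cases i
  · simp [hv]
  · simp [projY]
    field_simp
    ring

/-- `u - projV u • v` lies on `W`. -/
theorem projV_spec (u : Fin 2 → ℝ) : ∃ r : ℝ, u = P.projV u • P.v + r • P.w := by
  have hc := P.cross_ne_zero
  refine ⟨(P.v 0 * u 1 - P.v 1 * u 0) / (P.v 0 * P.w 1 - P.v 1 * P.w 0), ?_⟩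
  funext i
  fin_cases i <;> simp [projV] <;> rw [div_mul_eq_mul_div, div_mul_eq_mul_div, ← add_div,
    eq_div_iff hc] <;> ring

end ProjectionStructure

/-- The lattice `ℤ²` inside `ℚ²`. -/
def latticeZ2 : Set (Fin 2 → ℚ) := range fun (z : Fin 2 → ℤ) (i : Fin 2) => (z i : ℚ)

end

noncomputable section

/-! Everything is read off on `Y`. There `M` acts as multiplication by `mu`, so `σ` sends the tiling
whose window has base `y` to the one with base `mu * y - projY s`, with the open end switched
exactly when `det M = -1` (`subst_tiling`).

Since `lam` is irrational, `projY` is injective on rational vectors, and the lattice points over any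
interval of `Y` lie arbitrarily far along `V`. Hence vertices determine the window up to its end
points: two tilings are translates exactly if their bases differ by an element of `projY ℤ²` and
either the sides agree or no end point is the projection of a lattice point
(`translate_vertices_iff`).

Line: a tiling is fixed up to translation only if `(mu - 1) * y = projY (s + z)` with `z` in `ℤ²`,
and changing `y` by `projY ℤ²` changes `z` by `(M - I)ℤ²`. This leaves `|det (M - I)|` residue
classes. A class with non-singular window gives one fixed tiling. A singular class gives two
tilings, one per side: both are fixed if `det M = 1`, and they are swapped, hence lost, if `det M =
-1`. The singular classes are those of `-s` and `-(s + (M - I)l)`, as far as these vectors are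
integral, and they coincide exactly if `l` is integral.

Half-line: a half-line tiling still determines its base, so the base must be the fixed point `projY
s / (mu - 1)`. Only the side remains, and the two sides give different half-line tilings exactly if
some singular point projects to the positive half of `V` or to `0`. -/

theorem ofInt_add (x y : Fin 2 → ℤ) : ofInt (x + y) = ofInt x + ofInt y := by
  ext i; simp [ofInt]

theorem ofInt_sub (x y : Fin 2 → ℤ) : ofInt (x - y) = ofInt x - ofInt y := by
  ext i; simp [ofInt]

theorem ofInt_neg (x : Fin 2 → ℤ) : ofInt (-x) = -ofInt x := by
  ext i; simp [ofInt]

theorem ofInt_zero : ofInt 0 = 0 := by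
  ext i; simp [ofInt]

theorem ofRat_add (x y : Fin 2 → ℚ) : ofRat (x + y) = ofRat x + ofRat y := by
  ext i; simp [ofRat]

theorem ofRat_sub (x y : Fin 2 → ℚ) : ofRat (x - y) = ofRat x - ofRat y := by
  ext i; simp [ofRat]

/-- The inclusion `ℤ² ⊆ ℚ²`. -/
def intToRat (z : Fin 2 → ℤ) : Fin 2 → ℚ := fun i => (z i : ℚ)

theorem ofRat_intToRat (z : Fin 2 → ℤ) : ofRat (intToRat z) = ofInt z := by
  ext i; simp [ofInt, ofRat, intToRat]

theorem intToRat_injective : Function.Injective intToRat := fun x y h => by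
  ext i; simpa [intToRat] using congrFun h i

theorem mem_latticeZ2 {u : Fin 2 → ℚ} : u ∈ latticeZ2 ↔ ∃ z, intToRat z = u := Iff.rfl

theorem exists_mem_latticeZ2 {p : (Fin 2 → ℚ) → Prop} :
    (∃ u ∈ latticeZ2, p u) ↔ ∃ z, p (intToRat z) := by
  simp [mem_latticeZ2]

/-! ### Eigenvalues, projections and irrationality -/

namespace ProjectionStructure

variable (P : ProjectionStructure)

theorem projY_add (x y : Fin 2 → ℝ) : P.projY (x + y) = P.projY x + P.projY y := by
  simp only [projY, Pi.add_apply]; ring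

theorem projY_sub (x y : Fin 2 → ℝ) : P.projY (x - y) = P.projY x - P.projY y := by
  simp only [projY, Pi.sub_apply]; ring

theorem projY_neg (x : Fin 2 → ℝ) : P.projY (-x) = -P.projY x := by
  simp only [projY, Pi.neg_apply]; ring

theorem projY_zero : P.projY 0 = 0 := by simp [projY]

theorem projY_axis (y : ℝ) : P.projY ![0, y] = y := by
  simp [projY, P.v_zero_ne_zero]

theorem projV_add (x y : Fin 2 → ℝ) : P.projV (x + y) = P.projV x + P.projV y := by
  simp only [projV, Pi.add_apply]; ring

theorem projV_sub (x y : Fin 2 → ℝ) : P.projV (x - y) = P.projV x - P.projV y := by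
  simp only [projV, Pi.sub_apply]; ring

theorem projV_neg (x : Fin 2 → ℝ) : P.projV (-x) = -P.projV x := by
  simp only [projV, Pi.neg_apply]; ring

theorem projV_zero : P.projV 0 = 0 := by simp [projV]

theorem lam_pos : 0 < P.lam := one_pos.trans P.one_lt_lam

theorem v_eq_zero : (P.M 0 0 : ℝ) * P.v 0 + P.M 0 1 * P.v 1 = P.lam * P.v 0 := by
  simpa [Matrix.mulVec, dotProduct, Fin.sum_univ_two] using congrFun P.mulVec_v 0

theorem v_eq_one : (P.M 1 0 : ℝ) * P.v 0 + P.M 1 1 * P.v 1 = P.lam * P.v 1 := by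
  simpa [Matrix.mulVec, dotProduct, Fin.sum_univ_two] using congrFun P.mulVec_v 1

theorem charpoly_lam :
    P.lam ^ 2 - ((P.M 0 0 + P.M 1 1 : ℤ) : ℝ) * P.lam + (P.M.det : ℝ) = 0 := by
  have h0 := P.v_eq_zero
  have h1 := P.v_eq_one
  apply mul_left_cancel₀ P.v_zero_ne_zero
  rw [Matrix.det_fin_two]
  push_cast
  -- These coefficients eliminate `v 1` from the two eigenvector equations.
  linear_combination (P.M 1 1 - P.lam) * h0 - (P.M 0 1 : ℝ) * h1

theorem mu_eq : P.mu = (P.M 0 0 + P.M 1 1 : ℤ) - P.lam := by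
  unfold mu
  rw [div_eq_iff P.lam_pos.ne']
  linear_combination P.charpoly_lam

theorem act_apply_zero (u : Fin 2 → ℝ) : P.act u 0 = P.M 0 0 * u 0 + P.M 0 1 * u 1 := by
  simp [act, Matrix.mulVec, dotProduct, Fin.sum_univ_two]

theorem act_apply_one (u : Fin 2 → ℝ) : P.act u 1 = P.M 1 0 * u 0 + P.M 1 1 * u 1 := by
  simp [act, Matrix.mulVec, dotProduct, Fin.sum_univ_two]

/-- Since `V` is invariant, `M` acts on `ℝ²/V ≅ Y` by a scalar, namely the other eigenvalue, trace
minus `lam`. -/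
theorem projY_act (u : Fin 2 → ℝ) : P.projY (P.act u) = P.mu * P.projY u := by
  have hv := P.v_zero_ne_zero
  unfold projY
  rw [act_apply_zero, act_apply_one, mul_div_assoc', div_left_inj' hv, mu_eq]
  push_cast
  linear_combination (u 0) * P.v_eq_one - (u 1) * P.v_eq_zero

theorem actY_eq (y : ℝ) : P.actY y = P.mu * y := by
  rw [actY, projY_act, projY_axis]

theorem act_w : P.act P.w = P.mu • P.w := P.mulVec_w

theorem act_v : P.act P.v = P.lam • P.v := P.mulVec_v

theorem act_add (x y : Fin 2 → ℝ) : P.act (x + y) = P.act x + P.act y := Matrix.mulVec_add ..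

theorem act_smul (r : ℝ) (x : Fin 2 → ℝ) : P.act (r • x) = r • P.act x := Matrix.mulVec_smul ..

theorem projV_smul_v_add_smul_w (a b : ℝ) : P.projV (a • P.v + b • P.w) = a := by
  have hc := P.cross_ne_zero
  simp only [projV, Pi.add_apply, Pi.smul_apply, smul_eq_mul]
  rw [div_eq_iff hc]
  ring

theorem projV_act (u : Fin 2 → ℝ) : P.projV (P.act u) = P.lam * P.projV u := by
  obtain ⟨r, hr⟩ := P.projV_spec u
  have : P.act u = (P.projV u * P.lam) • P.v + (r * P.mu) • P.w := by
    conv_lhs => rw [hr, act_add, act_smul, act_smul, act_w, act_v, smul_smul, smul_smul]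
  rw [this, projV_smul_v_add_smul_w, mul_comm]

theorem act_ofInt (z : Fin 2 → ℤ) : P.act (ofInt z) = ofInt (P.M.mulVec z) := by
  ext i
  simp [act, ofInt, Matrix.mulVec, dotProduct]

theorem ofRat_matSub_mulVec (u : Fin 2 → ℚ) :
    ofRat (P.matSub.mulVec u) = P.act (ofRat u) - ofRat u := by
  ext i
  fin_cases i <;>
    simp [act, ofRat, matSub, Matrix.mulVec, dotProduct, Fin.sum_univ_two] <;> ring

theorem matSub_mulVec_intToRat (z : Fin 2 → ℤ) :
    P.matSub.mulVec (intToRat z) = intToRat ((P.M - 1).mulVec z) := by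
  ext i
  fin_cases i <;>
    simp [intToRat, matSub, Matrix.mulVec, dotProduct, Fin.sum_univ_two]

theorem projY_matSub_mulVec (u : Fin 2 → ℚ) :
    P.projY (ofRat (P.matSub.mulVec u)) = (P.mu - 1) * P.projY (ofRat u) := by
  rw [ofRat_matSub_mulVec, projY_sub, projY_act]; ring

/-- A rational root of the monic characteristic polynomial is an integer dividing `det M = ±1`,
which is impossible for `lam > 1`. -/
theorem irrational_lam : Irrational P.lam := by
  rintro ⟨q, hq⟩
  have hchar : q ^ 2 - ((P.M 0 0 + P.M 1 1 : ℤ) : ℚ) * q + (P.M.det : ℚ) = 0 := by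
    have := P.charpoly_lam
    rw [← hq] at this
    apply Rat.cast_injective (α := ℝ)
    push_cast at this ⊢
    exact this
  have hint : IsIntegral ℤ q := by
    open Polynomial in
    refine ⟨X ^ 2 - C (P.M 0 0 + P.M 1 1) * X + C P.M.det, by monicity!, ?_⟩
    simp only [eval₂_add, eval₂_sub, eval₂_mul, eval₂_pow, eval₂_X, eval₂_C]
    exact hchar
  obtain ⟨n, hn⟩ := IsIntegrallyClosed.isIntegral_iff.1 hint
  simp only [algebraMap_int_eq, eq_intCast] at hn
  rw [← hn] at hchar hq
  have hmul : n * (P.M 0 0 + P.M 1 1 - n) = P.M.det := by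
    have : n ^ 2 - (P.M 0 0 + P.M 1 1) * n + P.M.det = 0 := by exact_mod_cast hchar
    linear_combination -this
  have hunit : IsUnit n := isUnit_of_mul_isUnit_left (hmul ▸ P.isUnit_det)
  have hl := P.one_lt_lam
  rw [← hq] at hl
  rcases Int.isUnit_iff.1 hunit with h | h <;> rw [h] at hl <;> norm_num at hl

theorem irrational_mu : Irrational P.mu := by
  rw [mu_eq]
  exact P.irrational_lam.intCast_sub _

theorem not_irrational_of_act_eq_smul {u : Fin 2 → ℚ} (hu : u ≠ 0) {r : ℝ}
    (h : P.act (ofRat u) = r • ofRat u) : ¬ Irrational r := by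
  obtain ⟨i, hi⟩ := Function.ne_iff.1 hu
  have hi' : u i ≠ 0 := hi
  refine not_not.2 ⟨(∑ j, P.M i j * u j) / u i, ?_⟩
  have := congrFun h i
  simp only [act, ofRat, Matrix.mulVec, dotProduct, Matrix.map_apply, Pi.smul_apply,
    smul_eq_mul] at this
  push_cast
  rw [this, mul_div_assoc, div_self (by exact_mod_cast hi'), mul_one]

/-- A nonzero rational vector in the kernel `V` would be an eigenvector, making `lam` rational.
Equations between rational vectors may therefore be checked after `projY`. -/
theorem projY_ofRat_eq_zero {u : Fin 2 → ℚ} : P.projY (ofRat u) = 0 ↔ u = 0 := by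
  refine ⟨fun h => ?_, ?_⟩
  · by_contra hu
    obtain ⟨r, hr⟩ := P.projY_spec (ofRat u)
    have hr' : ofRat u = r • P.v := by
      rw [hr, h]
      ext i
      fin_cases i <;> simp
    refine P.not_irrational_of_act_eq_smul hu (r := P.lam) ?_ P.irrational_lam
    rw [hr', act_smul, act_v, smul_comm]
  · rintro rfl
    simp [projY, ofRat]

theorem projY_ofRat_injective : Function.Injective fun u => P.projY (ofRat u) := fun x y h => by
  simp only at h
  rw [← sub_eq_zero, ← projY_sub, ← ofRat_sub, projY_ofRat_eq_zero] at h
  exact sub_eq_zero.1 h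

theorem projY_ofInt_injective : Function.Injective fun z => P.projY (ofInt z) := fun x y h => by
  simp only [← ofRat_intToRat] at h
  exact intToRat_injective (P.projY_ofRat_injective h)

theorem projV_ofInt_eq_zero {z : Fin 2 → ℤ} : P.projV (ofInt z) = 0 ↔ z = 0 := by
  refine ⟨fun h => ?_, ?_⟩
  · by_contra hz
    obtain ⟨r, hr⟩ := P.projV_spec (ofInt z)
    rw [h, zero_smul, zero_add] at hr
    refine P.not_irrational_of_act_eq_smul (u := intToRat z) ?_ (r := P.mu) ?_ P.irrational_mu
    · intro h0
      exact hz (intToRat_injective (h0.trans (by ext i; simp [intToRat])))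
    · rw [ofRat_intToRat, hr, act_smul, act_w, smul_comm]
  · rintro rfl
    rw [ofInt_zero, projV_zero]

theorem projV_ofInt_injective : Function.Injective fun z => P.projV (ofInt z) := fun x y h => by
  simp only at h
  rw [← sub_eq_zero, ← projV_sub, ← ofInt_sub, projV_ofInt_eq_zero] at h
  exact sub_eq_zero.1 h

theorem mu_ne_zero : P.mu ≠ 0 := P.irrational_mu.ne_zero

theorem abs_mu_lt_one : |P.mu| < 1 := by
  have hl := P.one_lt_lam
  unfold mu
  rw [abs_div, abs_of_pos P.lam_pos, div_lt_one P.lam_pos]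
  rcases Int.isUnit_iff.1 P.isUnit_det with h | h <;> rw [h] <;> simpa using hl

theorem det_eq_one_or_neg_one : P.M.det = 1 ∨ P.M.det = -1 := Int.isUnit_iff.1 P.isUnit_det

theorem mu_neg (h : P.M.det = -1) : P.mu < 0 := by
  unfold mu
  rw [h]
  exact div_neg_of_neg_of_pos (by norm_num) P.lam_pos

theorem mu_sub_one_ne_zero : P.mu - 1 ≠ 0 := (sub_neg.2 P.mu_lt_one).ne

/-- Iterating `M` on a lattice point shrinks its `Y`-part like `mu ^ n` and stretches its `V`-part
like `lam ^ n`. -/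
theorem exists_lattice_small {ε : ℝ} (hε : 0 < ε) (K : ℝ) :
    ∃ z : Fin 2 → ℤ, P.projY (ofInt z) ≠ 0 ∧ |P.projY (ofInt z)| < ε ∧ K < P.projV (ofInt z) := by
  obtain ⟨x, hx⟩ : ∃ x : Fin 2 → ℤ, 0 < P.projV (ofInt x) := by
    have h1 : (![1, 0] : Fin 2 → ℤ) ≠ 0 := fun h => by simpa using congrFun h 0
    rcases lt_or_gt_of_ne (P.projV_ofInt_eq_zero.not.2 h1) with h | h
    · exact ⟨-![1, 0], by rw [ofInt_neg, projV_neg]; linarith⟩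
    · exact ⟨_, h⟩
  have hxY : P.projY (ofInt x) ≠ 0 := by
    intro h
    have : x = 0 := P.projY_ofInt_injective (by simp only [h, ofInt_zero, projY_zero])
    rw [this, ofInt_zero, projV_zero] at hx
    exact hx.false
  have hiter : ∀ n : ℕ, ∃ z : Fin 2 → ℤ, P.projY (ofInt z) = P.mu ^ n * P.projY (ofInt x) ∧
      P.projV (ofInt z) = P.lam ^ n * P.projV (ofInt x) := by
    intro n
    induction n with
    | zero => exact ⟨x, by simp⟩
    | succ n ih =>
      obtain ⟨z, h1, h2⟩ := ih
      refine ⟨P.M.mulVec z, ?_, ?_⟩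
      · rw [← act_ofInt, projY_act, h1]; ring
      · rw [← act_ofInt, projV_act, h2]; ring
  have e1 : ∀ᶠ n : ℕ in Filter.atTop, |P.mu ^ n * P.projY (ofInt x)| < ε := by
    have := (tendsto_pow_atTop_nhds_zero_of_abs_lt_one P.abs_mu_lt_one).mul_const
      (P.projY (ofInt x))
    rw [zero_mul] at this
    have := this.abs
    rw [abs_zero] at this
    exact this.eventually (gt_mem_nhds hε)
  have e2 : ∀ᶠ n : ℕ in Filter.atTop, K < P.lam ^ n * P.projV (ofInt x) :=
    ((tendsto_pow_atTop_atTop_of_one_lt P.one_lt_lam).atTop_mul_const hx).eventually_gt_atTop K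
  obtain ⟨n, h1, h2⟩ := (e1.and e2).exists
  obtain ⟨z, hY, hV⟩ := hiter n
  exact ⟨z, by rw [hY]; exact mul_ne_zero (pow_ne_zero _ P.mu_ne_zero) hxY, by rwa [hY],
    by rwa [hV]⟩

/-- The lattice points projecting to a given interval of `Y` lie arbitrarily far along `V`. -/
theorem exists_lattice_mem_Ioo {a b : ℝ} (hab : a < b) (K : ℝ) :
    ∃ z : Fin 2 → ℤ, P.projY (ofInt z) ∈ Ioo a b ∧ K < P.projV (ofInt z) := by
  let G : AddSubgroup ℝ :=
    { carrier := range fun z : Fin 2 → ℤ => P.projY (ofInt z)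
      zero_mem' := ⟨0, by simp only [ofInt_zero, projY_zero]⟩
      add_mem' := by
        rintro _ _ ⟨x, rfl⟩ ⟨y, rfl⟩
        exact ⟨x + y, by simp only [ofInt_add, projY_add]⟩
      neg_mem' := by
        rintro _ ⟨x, rfl⟩
        exact ⟨-x, by simp only [ofInt_neg, projY_neg]⟩ }
  -- A subgroup of `ℝ` with arbitrarily small nonzero elements is dense.
  have hd : Dense (G : Set ℝ) := by
    refine G.dense_of_not_isolated_zero fun ε hε => ?_
    obtain ⟨z, h0, h1, -⟩ := P.exists_lattice_small hε 0
    refine ⟨|P.projY (ofInt z)|, ?_, abs_pos.2 h0, h1⟩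
    have hz : P.projY (ofInt z) ∈ G := ⟨z, rfl⟩
    rcases abs_choice (P.projY (ofInt z)) with h | h <;> rw [h]
    exacts [hz, G.neg_mem hz]
  obtain ⟨_, ⟨x, rfl⟩, hx⟩ := hd.exists_between hab
  simp only at hx
  -- A lattice point over the interval is pushed far along `V` by a vector whose `Y`-part is too
  -- small to leave the interval.
  obtain ⟨y, -, h1, h2⟩ := P.exists_lattice_small
    (lt_min (sub_pos.2 hx.1) (sub_pos.2 hx.2)) (K - P.projV (ofInt x))
  refine ⟨x + y, ?_, ?_⟩
  · rw [ofInt_add, projY_add]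
    obtain ⟨h3, h4⟩ := lt_min_iff.1 h1
    exact ⟨by linarith [neg_abs_le (P.projY (ofInt y))],
      by linarith [le_abs_self (P.projY (ofInt y))]⟩
  · rw [ofInt_add, projV_add]
    linarith

end ProjectionStructure

/-! ### Half-open windows and translation equivalence of tilings -/

/-- The half-open interval of length `L` starting at `y`. -/
def halfOpen (L : ℝ) : Side → ℝ → Set ℝ
  | .left, y => Ico y (y + L)
  | .right, y => Ioc y (y + L)

theorem Ioo_subset_halfOpen (L : ℝ) (o : Side) (y : ℝ) : Ioo y (y + L) ⊆ halfOpen L o y := by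
  cases o
  exacts [Ioo_subset_Ico_self, Ioo_subset_Ioc_self]

theorem halfOpen_subset_Icc (L : ℝ) (o : Side) (y : ℝ) : halfOpen L o y ⊆ Icc y (y + L) := by
  cases o
  exacts [Ico_subset_Icc_self, Ioc_subset_Icc_self]

theorem sub_mem_halfOpen {L : ℝ} {o : Side} {x y c : ℝ} :
    x - c ∈ halfOpen L o y ↔ x ∈ halfOpen L o (y + c) := by
  cases o <;> simp only [halfOpen, mem_Ico, mem_Ioc] <;> constructor <;> rintro ⟨h1, h2⟩ <;>
    constructor <;> linarith

theorem Side.flip_ne (o : Side) : o.flip ≠ o := by cases o <;> simp [Side.flip]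

/-- The two half-open intervals with the same end points agree away from the end points. -/
theorem mem_halfOpen_iff_of_ne {L : ℝ} {o o' : Side} {x y : ℝ} (h1 : x ≠ y) (h2 : x ≠ y + L) :
    x ∈ halfOpen L o y ↔ x ∈ halfOpen L o' y := by
  have : ∀ o : Side, x ∈ halfOpen L o y ↔ x ∈ Ioo y (y + L) := by
    intro o
    cases o <;> simp only [halfOpen, mem_Ico, mem_Ioc, mem_Ioo, le_iff_lt_or_eq, h1.symm, h2,
      or_false]
  rw [this, this]

theorem left_mem_halfOpen {L : ℝ} (hL : 0 < L) {o : Side} {y : ℝ} :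
    y ∈ halfOpen L o y ↔ o = .left := by
  cases o <;> simp [halfOpen, hL]

theorem right_mem_halfOpen {L : ℝ} (hL : 0 < L) {o : Side} {y : ℝ} :
    y + L ∈ halfOpen L o y ↔ o = .right := by
  cases o <;> simp [halfOpen, hL]

namespace ProjectionStructure

variable (P : ProjectionStructure)

theorem window_eq (l : Fin 2 → ℝ) (o : Side) (t : Fin 2 → ℝ) :
    P.window l o t = halfOpen (P.projY l) o (P.projY t) := by
  cases o <;> rfl

/-- The vertex set of the interval projection tiling with window `halfOpen L o y`. -/
def vertices (L : ℝ) (o : Side) (y : ℝ) : Set ℝ :=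
  {x | ∃ z : Fin 2 → ℤ, P.projY (ofInt z) ∈ halfOpen L o y ∧ P.projV (ofInt z) = x}

theorem vert_tiling {A : Type*} (lab : Side → ℝ → A) (l : Fin 2 → ℝ) (o : Side)
    (t : Fin 2 → ℝ) :
    vert (P.tiling lab l o t) = P.vertices (P.projY l) o (P.projY t) := by
  ext x
  simp only [vert, tiling, vertices, mem_image, mem_ofPred_eq, ← window_eq]
  constructor
  · rintro ⟨_, ⟨z, hz, rfl⟩, rfl⟩
    exact ⟨z, hz, rfl⟩
  · rintro ⟨z, hz, rfl⟩
    exact ⟨_, ⟨z, hz, rfl⟩, rfl⟩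

theorem projV_mem_vertices {L : ℝ} {o : Side} {y : ℝ} {z : Fin 2 → ℤ} :
    P.projV (ofInt z) ∈ P.vertices L o y ↔ P.projY (ofInt z) ∈ halfOpen L o y := by
  constructor
  · rintro ⟨x, hx, h⟩
    rwa [← P.projV_ofInt_injective h]
  · intro h
    exact ⟨z, h, rfl⟩

/-- An end point of the interval from `y` to `y + L` is the projection of a lattice point. -/
def IsSingular (L y : ℝ) : Prop :=
  ∃ z : Fin 2 → ℤ, P.projY (ofInt z) = y ∨ P.projY (ofInt z) = y + L

theorem IsSingular.add {L y : ℝ} (h : P.IsSingular L y) (x : Fin 2 → ℤ) :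
    P.IsSingular L (y + P.projY (ofInt x)) := by
  obtain ⟨z, hz⟩ := h
  refine ⟨z + x, ?_⟩
  rw [ofInt_add, projY_add]
  exact hz.imp (by intro h; rw [h]) (by intro h; rw [h]; ring)

theorem isSingular_add_iff {L y : ℝ} (x : Fin 2 → ℤ) :
    P.IsSingular L (y + P.projY (ofInt x)) ↔ P.IsSingular L y := by
  refine ⟨fun h => ?_, fun h => h.add P x⟩
  simpa [ofInt_neg, projY_neg] using h.add P (-x)

/-- If the bases differ, some lattice point lies over the part of one window that precedes the
other. It can be taken far along `V`, so testing the positive half suffices, as the half-line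
requires. -/
theorem halfOpen_base_unique {L : ℝ} (hL : 0 < L) {o o' : Side} {y y' : ℝ}
    (h : ∀ z : Fin 2 → ℤ, 0 < P.projV (ofInt z) →
      (P.projY (ofInt z) ∈ halfOpen L o y ↔ P.projY (ofInt z) ∈ halfOpen L o' y')) :
    y = y' := by
  have key : ∀ {o o' : Side} {y y' : ℝ}, (∀ z : Fin 2 → ℤ, 0 < P.projV (ofInt z) →
      P.projY (ofInt z) ∈ halfOpen L o y → P.projY (ofInt z) ∈ halfOpen L o' y') → y' ≤ y := by
    intro o o' y y' h
    by_contra! hlt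
    obtain ⟨z, hz, hV⟩ := P.exists_lattice_mem_Ioo
      (lt_min hlt (lt_add_of_pos_right y hL)) 0
    obtain ⟨h1, h2⟩ := lt_min_iff.1 hz.2
    exact h1.not_ge (halfOpen_subset_Icc _ _ _
      (h z hV (Ioo_subset_halfOpen _ _ _ ⟨hz.1, h2⟩))).1
  exact le_antisymm (key fun z hz => (h z hz).2) (key fun z hz => (h z hz).1)

theorem forall_mem_halfOpen_iff {L : ℝ} (hL : 0 < L) {o o' : Side} {y : ℝ} :
    (∀ z : Fin 2 → ℤ, P.projY (ofInt z) ∈ halfOpen L o y ↔ P.projY (ofInt z) ∈ halfOpen L o' y) ↔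
      o = o' ∨ ¬ P.IsSingular L y := by
  constructor
  · rintro h
    refine or_iff_not_imp_right.2 fun hs => ?_
    obtain ⟨z, hz⟩ := not_not.1 hs
    have := h z
    rcases hz with hz | hz <;> rw [hz] at this
    · rw [left_mem_halfOpen hL, left_mem_halfOpen hL] at this
      cases o <;> cases o' <;> simp_all
    · rw [right_mem_halfOpen hL, right_mem_halfOpen hL] at this
      cases o <;> cases o' <;> simp_all
  · rintro (rfl | h) z
    · rfl
    · exact mem_halfOpen_iff_of_ne (fun h' => h ⟨z, Or.inl h'⟩) fun h' => h ⟨z, Or.inr h'⟩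

/-- Two interval projection tilings are translates of each other exactly if their windows are
translates by a lattice point, up to end points that are not projections of lattice points. -/
theorem translate_vertices_iff {L : ℝ} (hL : 0 < L) {o o' : Side} {y y' : ℝ} :
    (∃ c : ℝ, P.vertices L o' y' = (fun x => x + c) '' P.vertices L o y) ↔
      (∃ x : Fin 2 → ℤ, y' = y + P.projY (ofInt x)) ∧ (o = o' ∨ ¬ P.IsSingular L y) := by
  -- Translating by `projV x` shifts the window by `projY x`; injectivity of `projV` then turns
  -- equality of vertex sets into equality of sets of lattice points.
  have key : ∀ x : Fin 2 → ℤ,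
      P.vertices L o' y' = (fun u => u + P.projV (ofInt x)) '' P.vertices L o y ↔
        ∀ z : Fin 2 → ℤ, P.projY (ofInt z) ∈ halfOpen L o' y' ↔
          P.projY (ofInt z) ∈ halfOpen L o (y + P.projY (ofInt x)) := by
    intro x
    have himg : (fun u => u + P.projV (ofInt x)) '' P.vertices L o y =
        P.vertices L o (y + P.projY (ofInt x)) := by
      ext u
      constructor
      · rintro ⟨_, ⟨z, hz, rfl⟩, rfl⟩
        refine ⟨z + x, ?_, by rw [ofInt_add, projV_add]⟩
        rw [← sub_mem_halfOpen, ofInt_add, projY_add, add_sub_cancel_right]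
        exact hz
      · rintro ⟨z, hz, rfl⟩
        refine ⟨_, ⟨z - x, ?_, rfl⟩, by simp only [ofInt_sub, projV_sub, sub_add_cancel]⟩
        rw [ofInt_sub, projY_sub]
        exact sub_mem_halfOpen.2 hz
    rw [himg]
    constructor
    · intro h z
      rw [← projV_mem_vertices, h, projV_mem_vertices]
    · intro h
      ext u
      simp only [vertices, mem_ofPred_eq, h]
  constructor
  · rintro ⟨c, hc⟩
    obtain ⟨z, hz, -⟩ := P.exists_lattice_mem_Ioo (lt_add_of_pos_right y' hL) 0
    have hz' := P.projV_mem_vertices.2 (Ioo_subset_halfOpen L o' y' hz)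
    rw [hc] at hz'
    obtain ⟨_, ⟨x, hx, rfl⟩, hcx⟩ := hz'
    -- Both tilings have lattice vertices, so every translation between them comes from a lattice
    -- vector.
    have hc' : c = P.projV (ofInt (z - x)) := by
      rw [ofInt_sub, projV_sub, ← hcx]; ring
    rw [hc', key] at hc
    have hy : y' = y + P.projY (ofInt (z - x)) := P.halfOpen_base_unique hL fun z _ => hc z
    refine ⟨⟨_, hy⟩, ?_⟩
    rw [← hy, P.forall_mem_halfOpen_iff hL, hy, isSingular_add_iff] at hc
    exact hc.imp_left Eq.symm
  · rintro ⟨⟨x, rfl⟩, h⟩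
    refine ⟨P.projV (ofInt x), (key x).2 ?_⟩
    rw [P.forall_mem_halfOpen_iff hL, isSingular_add_iff]
    exact h.imp_left Eq.symm

/-- The effect of `M` on the orientation of `Y`. -/
def turn (o : Side) : Side := if P.M.det = 1 then o else o.flip

theorem turn_eq_self_iff (o : Side) : P.turn o = o ↔ P.M.det = 1 := by
  unfold turn
  split_ifs with h <;> simp [h, Side.flip_ne]

theorem turn_turn (o : Side) : P.turn (P.turn o) = o := by
  unfold turn
  split_ifs <;> cases o <;> rfl

/-! ### The action of the substitution on windows -/

section Substitution

variable {P} {A : Type*} {σ : SubstitutionRule A} {lab : Side → ℝ → A} {s l : Fin 2 → ℝ}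

/-- The inflated window is the old one multiplied by `mu`; it is the subwindow for `t'` as soon as
`projY (s + t') = mu * projY t`. -/
theorem IsSubstitutionRule.subst_tiling (hσ : P.IsSubstitutionRule σ lab s l) (o : Side)
    (t t' : Fin 2 → ℝ) (ht : P.projY t' = P.mu * P.projY t - P.projY s) :
    σ.subst (P.tiling lab l o t) = P.tiling lab l (P.turn o) t' := by
  refine hσ.subst_eq _ _ _ _ ?_
  have hside : (if P.M.det = 1 then P.turn o else (P.turn o).flip) = o := P.turn_turn o
  rw [subwindow, hside, window_eq, window_eq, projY_zero]
  have himg : halfOpen (P.projY l) o (P.projY t) =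
      (fun y => y + P.projY t) '' halfOpen (P.projY l) o 0 := by
    ext y
    simp only [mem_image]
    constructor
    · intro hy
      refine ⟨y - P.projY t, ?_, by ring⟩
      rwa [sub_mem_halfOpen, zero_add]
    · rintro ⟨x, hx, rfl⟩
      have := sub_mem_halfOpen (L := P.projY l) (o := o) (x := x + P.projY t) (y := 0)
        (c := P.projY t)
      rw [add_sub_cancel_right, zero_add] at this
      exact this.1 hx
  rw [himg, image_image]
  refine image_congr fun y _ => ?_
  rw [actY_eq, actY_eq, projY_add, ht]
  ring

theorem IsSubstitutionRule.vert_subst_tiling (hσ : P.IsSubstitutionRule σ lab s l) (o : Side)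
    (t : Fin 2 → ℝ) :
    vert (σ.subst (P.tiling lab l o t)) =
      P.vertices (P.projY l) (P.turn o) (P.mu * P.projY t - P.projY s) := by
  rw [hσ.subst_tiling o t ![0, P.mu * P.projY t - P.projY s] (P.projY_axis _), vert_tiling,
    projY_axis]

/-- The containment of the subwindow is tested at the images of the two window ends. For `det M =
-1` the ends are interchanged, and the negative sign of `mu` makes the bounds strict. -/
theorem IsSubstitutionRule.projY_bounds (hσ : P.IsSubstitutionRule σ lab s l)
    (hl : 0 < P.projY l) :
    0 ≤ P.projY s ∧ P.projY s ≤ (1 - P.mu) * P.projY l ∧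
      (P.M.det = -1 → 0 < P.projY s ∧ P.projY s < (1 - P.mu) * P.projY l) := by
  have hsub := hσ.subwindow_subset
  simp only [subwindow, window_eq, actY_eq, projY_zero] at hsub
  rcases P.det_eq_one_or_neg_one with h | h
  · have hmem : ∀ o : Side, ∀ y ∈ halfOpen (P.projY l) o 0,
        P.mu * y + P.projY (s + 0) ∈ halfOpen (P.projY l) o (P.projY 0) := by
      intro o y hy
      exact hsub o 0 ⟨y, by rwa [if_pos h], rfl⟩
    have h1 := hmem .left 0 ((left_mem_halfOpen hl).2 rfl)
    have h2 := hmem .right (0 + P.projY l) ((right_mem_halfOpen hl).2 rfl)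
    rw [add_zero, projY_zero] at h1 h2
    refine ⟨?_, ?_, fun h' => by rw [h] at h'; norm_num at h'⟩
    · linarith [(halfOpen_subset_Icc _ _ _ h1).1]
    · linarith [(halfOpen_subset_Icc _ _ _ h2).2]
  · have hmu := P.mu_neg h
    have hdet : P.M.det ≠ 1 := by rw [h]; norm_num
    have hmem : ∀ o : Side, ∀ y ∈ halfOpen (P.projY l) o.flip 0,
        P.mu * y + P.projY (s + 0) ∈ halfOpen (P.projY l) o (P.projY 0) := by
      intro o y hy
      exact hsub o 0 ⟨y, by rwa [if_neg hdet], rfl⟩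
    have h1 := hmem .right 0 ((left_mem_halfOpen hl).2 rfl)
    have h2 := hmem .left (0 + P.projY l) ((right_mem_halfOpen hl).2 rfl)
    rw [add_zero, projY_zero] at h1 h2
    have h3 := (halfOpen_subset_Icc _ _ _ h1).2
    have h4 := (halfOpen_subset_Icc _ _ _ h2).1
    have h5 := mul_neg_of_neg_of_pos hmu hl
    refine ⟨?_, ?_, fun _ => ⟨?_, ?_⟩⟩ <;> nlinarith

end Substitution

end ProjectionStructure

namespace SubstitutionRule

variable {A : Type*} (σ : SubstitutionRule A)

theorem sum_map_length_nonneg (as : List A) : 0 ≤ (as.map σ.length).sum :=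
  List.sum_nonneg fun _ hx => by
    obtain ⟨a, -, rfl⟩ := List.mem_map.1 hx
    exact (σ.length_pos a).le

theorem sum_map_length_take_lt (as : List A) (i : Fin as.length) :
    ((as.take i).map σ.length).sum < (as.map σ.length).sum := by
  conv_rhs => rw [← List.take_append_drop i as, List.drop_eq_getElem_cons i.2]
  rw [List.map_append, List.sum_append, List.map_cons, List.sum_cons]
  linarith [σ.length_pos as[i], σ.sum_map_length_nonneg (as.drop (i + 1)),
    show σ.length as[(i : ℕ)] = σ.length as[i] from rfl]

/-- At a vertex of a tiling placed at the origin, substitution respects the positive half-line. -/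
theorem subst_halfLine {X : Set (ℝ × A)} (hX : σ.IsTiling X) (h0 : 0 ∈ vert X) :
    σ.subst (halfLine X) = halfLine (σ.subst X) := by
  have hf : 0 < σ.factor := one_pos.trans σ.one_lt_factor
  ext T
  constructor
  · rintro ⟨x, a, ⟨hx, hx0⟩, i, rfl⟩
    exact ⟨⟨x, a, hx, i, rfl⟩, add_nonneg (mul_nonneg hf.le hx0) (σ.sum_map_length_nonneg _)⟩
  · rintro ⟨⟨x, a, hx, i, rfl⟩, hT⟩
    refine ⟨x, a, ⟨hx, ?_⟩, i, rfl⟩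
    by_contra! hneg
    simp only at hneg hT
    obtain ⟨⟨_, b⟩, hb, rfl⟩ := h0
    -- A tile starting left of `0` cannot reach past `0` without overlapping the tile that starts at
    -- `0`.
    have hend : x + σ.length a ≤ 0 := by
      by_contra! hpos
      have hdisj := hX.2 hx hb fun h => hneg.ne (congrArg Prod.fst h)
      have hm := lt_min hpos (σ.length_pos b)
      have h1 := min_le_left (x + σ.length a) (σ.length b)
      have h2 := min_le_right (x + σ.length a) (σ.length b)
      have hmem : min (x + σ.length a) (σ.length b) / 2 ∈ Ioo x (x + σ.length a) :=
        ⟨by linarith, by linarith⟩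
      exact Set.disjoint_left.1 hdisj hmem ⟨by simp only; linarith, by simp only; linarith⟩
    -- Replacement tiles start strictly before the end of the inflated tile, hence before `0`.
    have hlt := σ.sum_map_length_take_lt (σ.replace a) i
    rw [σ.covers] at hlt
    nlinarith [mul_nonpos_of_nonneg_of_nonpos hf.le hend]

end SubstitutionRule

theorem vert_halfLine {A : Type*} (X : Set (ℝ × A)) : vert (halfLine X) = vert X ∩ Ici 0 := by
  ext x
  constructor
  · rintro ⟨T, ⟨hT, h0⟩, rfl⟩
    exact ⟨⟨T, hT, rfl⟩, h0⟩
  · rintro ⟨⟨T, hT, rfl⟩, h0⟩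
    exact ⟨T, ⟨hT, h0⟩, rfl⟩

/-! ### Fixed tilings of the half-line -/

namespace ProjectionStructure

variable (P : ProjectionStructure)

/-- The vertex set of the restriction of an interval projection tiling to `[0, ∞)`. -/
def halfVertices (L : ℝ) (o : Side) (y : ℝ) : Set ℝ := P.vertices L o y ∩ Ici 0

theorem halfVertices_eq_iff {L : ℝ} {o o' : Side} {y y' : ℝ} :
    P.halfVertices L o y = P.halfVertices L o' y' ↔
      ∀ z : Fin 2 → ℤ, 0 ≤ P.projV (ofInt z) →
        (P.projY (ofInt z) ∈ halfOpen L o y ↔ P.projY (ofInt z) ∈ halfOpen L o' y') := by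
  constructor
  · intro h z hz
    have := Set.ext_iff.1 h (P.projV (ofInt z))
    simpa only [halfVertices, mem_inter_iff, projV_mem_vertices, mem_Ici, hz, and_true] using this
  · intro h
    ext x
    constructor
    · rintro ⟨⟨z, hz, rfl⟩, h0⟩
      exact ⟨⟨z, (h z h0).1 hz, rfl⟩, h0⟩
    · rintro ⟨⟨z, hz, rfl⟩, h0⟩
      exact ⟨⟨z, (h z h0).2 hz, rfl⟩, h0⟩

theorem halfVertices_left_eq_right_iff {L : ℝ} (hL : 0 < L) {y : ℝ} :
    P.halfVertices L .left y = P.halfVertices L .right y ↔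
      ∀ z : Fin 2 → ℤ, P.projY (ofInt z) = y ∨ P.projY (ofInt z) = y + L →
        P.projV (ofInt z) < 0 := by
  rw [halfVertices_eq_iff]
  constructor
  · intro h z hz
    by_contra! h0
    have := h z h0
    rcases hz with hz | hz <;> rw [hz] at this
    · simp [left_mem_halfOpen hL] at this
    · simp [right_mem_halfOpen hL] at this
  · intro h z h0
    exact mem_halfOpen_iff_of_ne (fun h' => (h z (Or.inl h')).not_ge h0)
      fun h' => (h z (Or.inr h')).not_ge h0

section HalfLine

variable {P} {A : Type*} {σ : SubstitutionRule A} {lab : Side → ℝ → A} {s l : Fin 2 → ℝ}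

/-- The half-line part determines the base, so the base is the fixed point of `y ↦ mu * y - projY
s`. The vertex `0` can only come from the lattice point `0`, so the window must contain `0`. -/
theorem mem_fixedHalfTilings (hσ : P.IsSubstitutionRule σ lab s l) (hl : 0 < P.projY l)
    {H : Set ℝ} :
    H ∈ P.fixedHalfTilings σ lab l ↔ ∃ o, 0 ∈ halfOpen (P.projY l) o (P.iwiLeft s) ∧
      P.halfVertices (P.projY l) o (P.iwiLeft s) = H ∧
      P.halfVertices (P.projY l) (P.turn o) (P.iwiLeft s) = H := by
  have hmu := P.mu_sub_one_ne_zero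
  have hfix : P.mu * P.iwiLeft s - P.projY s = P.iwiLeft s := by
    unfold iwiLeft
    field_simp
    ring
  have hzero : ∀ {o : Side} {y : ℝ}, 0 ∈ P.vertices (P.projY l) o y ↔
      0 ∈ halfOpen (P.projY l) o y := by
    intro o y
    have := P.projV_mem_vertices (L := P.projY l) (o := o) (y := y) (z := 0)
    rwa [ofInt_zero, projV_zero, projY_zero] at this
  have hsubst : ∀ o t, 0 ∈ vert (P.tiling lab l o t) →
      vert (σ.subst (halfLine (P.tiling lab l o t))) =
        P.halfVertices (P.projY l) (P.turn o) (P.mu * P.projY t - P.projY s) := by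
    intro o t h0
    rw [σ.subst_halfLine (hσ.isTiling o t) h0, vert_halfLine, hσ.vert_subst_tiling, halfVertices]
  constructor
  · rintro ⟨o, t, h0, rfl, h⟩
    rw [hsubst o t h0, vert_halfLine, vert_tiling, ← halfVertices] at h
    have hbase : P.mu * P.projY t - P.projY s = P.projY t :=
      P.halfOpen_base_unique hl fun z hz => P.halfVertices_eq_iff.1 h z hz.le
    have ht : P.projY t = P.iwiLeft s := by
      unfold iwiLeft
      rw [eq_div_iff hmu]
      linarith
    rw [vert_tiling, hzero, ht] at h0
    rw [hbase, ht] at h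
    rw [vert_halfLine, vert_tiling, ht, ← halfVertices]
    exact ⟨o, h0, rfl, h⟩
  · rintro ⟨o, h0, rfl, h⟩
    have h0' : 0 ∈ vert (P.tiling lab l o ![0, P.iwiLeft s]) := by
      rwa [vert_tiling, projY_axis, hzero]
    refine ⟨o, ![0, P.iwiLeft s], h0', ?_, ?_⟩
    · rw [vert_halfLine, vert_tiling, projY_axis, halfVertices]
    · rw [hsubst _ _ h0', projY_axis, hfix, h]

theorem fixedHalfTilings_subset (hσ : P.IsSubstitutionRule σ lab s l) (hl : 0 < P.projY l) :
    P.fixedHalfTilings σ lab l ⊆ {P.halfVertices (P.projY l) .left (P.iwiLeft s),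
      P.halfVertices (P.projY l) .right (P.iwiLeft s)} := by
  intro H hH
  obtain ⟨o, -, rfl, -⟩ := (mem_fixedHalfTilings hσ hl).1 hH
  cases o <;> simp

theorem zero_mem_iwi (hσ : P.IsSubstitutionRule σ lab s l) (hl : 0 < P.projY l) :
    0 ∈ Icc (P.iwiLeft s) (P.iwiRight s l) ∧
      (P.M.det = -1 → P.iwiLeft s ≠ 0 ∧ P.iwiRight s l ≠ 0) := by
  have hmu : P.mu - 1 < 0 := sub_neg.2 P.mu_lt_one
  obtain ⟨h1, h2, h3⟩ := hσ.projY_bounds hl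
  have hright : (P.mu - 1) * P.iwiRight s l = P.projY s - (1 - P.mu) * P.projY l := by
    rw [iwiRight, mul_add, mul_div_cancel₀ _ hmu.ne]
    ring
  refine ⟨⟨div_nonpos_of_nonneg_of_nonpos h1 hmu.le, ?_⟩, fun h => ⟨?_, fun h0 => ?_⟩⟩
  · by_contra! hneg
    nlinarith [mul_pos_of_neg_of_neg hmu hneg]
  · exact div_ne_zero (h3 h).1.ne' hmu.ne
  · rw [h0, mul_zero] at hright
    linarith [(h3 h).2]

theorem fixedHalfTilings_of_iwi_end (hσ : P.IsSubstitutionRule σ lab s l) (hl : 0 < P.projY l)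
    (h : P.iwiLeft s = 0 ∨ P.iwiRight s l = 0) :
    P.M.det = 1 ∧ (P.fixedHalfTilings σ lab l).ncard = 1 := by
  have hdet : P.M.det = 1 := P.det_eq_one_or_neg_one.resolve_right fun h' =>
    h.elim ((zero_mem_iwi hσ hl).2 h').1 ((zero_mem_iwi hσ hl).2 h').2
  refine ⟨hdet, ncard_eq_one.2 ?_⟩
  -- Only one of the two half-open windows contains the end point `0`.
  obtain ⟨o, ho⟩ : ∃ o₀, ∀ o, 0 ∈ halfOpen (P.projY l) o (P.iwiLeft s) ↔ o = o₀ := by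
    rcases h with h | h
    · exact ⟨.left, fun o => by
        rw [← left_mem_halfOpen hl (o := o) (y := P.iwiLeft s), h]⟩
    · refine ⟨.right, fun o => ?_⟩
      rw [← right_mem_halfOpen hl (o := o) (y := P.iwiLeft s)]
      rw [show P.iwiLeft s + P.projY l = 0 from h]
  refine ⟨P.halfVertices (P.projY l) o (P.iwiLeft s), ?_⟩
  ext H
  simp only [mem_fixedHalfTilings hσ hl, ho, exists_eq_left, (P.turn_eq_self_iff o).2 hdet,
    and_self, mem_singleton_iff]
  exact eq_comm

theorem mem_fixedHalfTilings_of_interior (hσ : P.IsSubstitutionRule σ lab s l)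
    (hl : 0 < P.projY l) (h : 0 ∈ Ioo (P.iwiLeft s) (P.iwiRight s l)) {H : Set ℝ} :
    H ∈ P.fixedHalfTilings σ lab l ↔ ∃ o, P.halfVertices (P.projY l) o (P.iwiLeft s) = H ∧
      P.halfVertices (P.projY l) (P.turn o) (P.iwiLeft s) = H := by
  rw [mem_fixedHalfTilings hσ hl]
  exact exists_congr fun o => and_iff_right (Ioo_subset_halfOpen _ _ _ h)

theorem ncard_fixedHalfTilings_of_eq (hσ : P.IsSubstitutionRule σ lab s l)
    (hl : 0 < P.projY l) (h : 0 ∈ Ioo (P.iwiLeft s) (P.iwiRight s l))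
    (heq : ∀ z, P.SingularPoint s l z → P.projV (ofInt z) < 0) :
    (P.fixedHalfTilings σ lab l).ncard = 1 := by
  have heq' := (P.halfVertices_left_eq_right_iff hl).2 heq
  have hall : ∀ o, P.halfVertices (P.projY l) o (P.iwiLeft s) =
      P.halfVertices (P.projY l) .left (P.iwiLeft s) := by
    intro o
    cases o
    exacts [rfl, heq'.symm]
  refine ncard_eq_one.2 ⟨P.halfVertices (P.projY l) .left (P.iwiLeft s), ?_⟩
  ext H
  rw [mem_fixedHalfTilings_of_interior hσ hl h]
  simp only [hall, and_self, mem_singleton_iff, eq_comm]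
  exact ⟨fun ⟨_, h⟩ => h, fun h => ⟨.left, h⟩⟩

theorem ncard_fixedHalfTilings_of_ne (hσ : P.IsSubstitutionRule σ lab s l)
    (hl : 0 < P.projY l) (h : 0 ∈ Ioo (P.iwiLeft s) (P.iwiRight s l))
    (hne : ∃ z, P.SingularPoint s l z ∧ 0 < P.projV (ofInt z)) :
    (P.M.det = 1 → (P.fixedHalfTilings σ lab l).ncard = 2) ∧
      (P.M.det = -1 → (P.fixedHalfTilings σ lab l).ncard = 0) := by
  have hne' : P.halfVertices (P.projY l) .left (P.iwiLeft s) ≠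
      P.halfVertices (P.projY l) .right (P.iwiLeft s) := by
    intro h'
    obtain ⟨z, hz, h0⟩ := hne
    exact ((P.halfVertices_left_eq_right_iff hl).1 h' z hz).not_gt h0
  constructor
  · intro hdet
    rw [← ncard_pair hne']
    congr 1
    ext H
    simp only [mem_fixedHalfTilings_of_interior hσ hl h, (P.turn_eq_self_iff _).2 hdet, and_self,
      mem_insert_iff, mem_singleton_iff]
    constructor
    · rintro ⟨o, rfl⟩
      cases o <;> simp
    · rintro (rfl | rfl)
      exacts [⟨_, rfl⟩, ⟨_, rfl⟩]
  · intro hdet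
    have hdet' : P.M.det ≠ 1 := by rw [hdet]; norm_num
    convert ncard_empty (Set ℝ)
    rw [eq_empty_iff_forall_notMem]
    intro H hH
    obtain ⟨o, h1, h2⟩ := (mem_fixedHalfTilings_of_interior hσ hl h).1 hH
    rw [turn, if_neg hdet'] at h2
    cases o
    exacts [hne' (h1.trans h2.symm), hne' (h2.trans h1.symm)]

end HalfLine

theorem singularPoint_iff (s l : Fin 2 → ℚ) (z : Fin 2 → ℤ) :
    P.SingularPoint (ofRat s) (ofRat l) z ↔
      s = P.matSub.mulVec (intToRat z) ∨ s = P.matSub.mulVec (intToRat z - l) := by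
  have hmu := P.mu_sub_one_ne_zero
  have key : ∀ u : Fin 2 → ℚ, s = P.matSub.mulVec u ↔
      P.projY (ofRat u) = P.iwiLeft (ofRat s) := by
    intro u
    rw [← P.projY_ofRat_injective.eq_iff, projY_matSub_mulVec, iwiLeft, eq_div_iff hmu, mul_comm,
      eq_comm]
  rw [key, key, ofRat_sub, projY_sub, sub_eq_iff_eq_add, ofRat_intToRat]
  rfl

theorem iwiSingular_iff (s l : Fin 2 → ℚ) :
    P.IWISingular (ofRat s) (ofRat l) ↔
      (∃ z ∈ latticeZ2, s = P.matSub.mulVec z) ∨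
        ∃ z ∈ latticeZ2, s = P.matSub.mulVec (z - l) := by
  simp only [exists_mem_latticeZ2, ← exists_or, IWISingular, singularPoint_iff]

end ProjectionStructure

/-- Counting classes of a family indexed by a finite type, where every member occurs on both sides
and the two sides coincide exactly outside an exceptional set. -/
theorem ncard_range_of_two_sides {Q X : Type*} [Finite Q] {f : Side → Q → X} {E : Set Q}
    (hf : ∀ o q o' q', f o q = f o' q' ↔ q = q' ∧ (o = o' ∨ q ∉ E)) :
    {x | ∃ o q, x = f o q}.ncard = Nat.card Q + E.ncard ∧
      {x | ∃ o q, x = f o q ∧ q ∉ E}.ncard + E.ncard = Nat.card Q := by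
  have hinj : ∀ o, Function.Injective (f o) := fun o q q' h => ((hf _ _ _ _).1 h).1
  constructor
  -- Right-hand members outside `E` repeat left-hand ones, so only those in `E` are new.
  · have heq : {x | ∃ o q, x = f o q} = f .left '' univ ∪ f .right '' E := by
      ext x
      constructor
      · rintro ⟨o, q, rfl⟩
        by_cases hq : o = .left ∨ q ∉ E
        · exact Or.inl ⟨q, mem_univ q, (hf _ _ _ _).2 ⟨rfl, hq.imp_left Eq.symm⟩⟩
        · cases o
          · simp at hq
          · exact Or.inr ⟨q, by simpa using hq, rfl⟩
      · rintro (⟨q, -, rfl⟩ | ⟨q, -, rfl⟩)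
        exacts [⟨_, _, rfl⟩, ⟨_, _, rfl⟩]
    have hdisj : Disjoint (f .left '' univ) (f .right '' E) := by
      rw [Set.disjoint_left]
      rintro _ ⟨q, -, rfl⟩ ⟨q', hq', h⟩
      exact ((hf _ _ _ _).1 h).2.elim (fun h => by cases h) fun h => h hq'
    rw [heq, ncard_union_eq hdisj (toFinite _) (toFinite _), ncard_image_of_injective _ (hinj _),
      ncard_image_of_injective _ (hinj _), ncard_univ]
  · have heq : {x | ∃ o q, x = f o q ∧ q ∉ E} = f .left '' Eᶜ := by
      ext x
      constructor
      · rintro ⟨o, q, rfl, hq⟩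
        exact ⟨q, hq, (hf _ _ _ _).2 ⟨rfl, Or.inr hq⟩⟩
      · rintro ⟨q, hq, rfl⟩
        exact ⟨_, _, rfl, hq⟩
    rw [heq, ncard_image_of_injective _ (hinj _), add_comm, ncard_add_ncard_compl]

/-! ### Residue classes modulo `(M - I)ℤ²` and tilings of the line -/

namespace ProjectionStructure

variable (P : ProjectionStructure)

/-- The sublattice `(M - I)ℤ²`. -/
def subLattice : Submodule ℤ (Fin 2 → ℤ) := LinearMap.range (P.M - 1).mulVecLin

theorem matSub_mulVec_injective : Function.Injective P.matSub.mulVec := fun x y h => by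
  refine P.projY_ofRat_injective (mul_left_cancel₀ P.mu_sub_one_ne_zero ?_)
  rw [← projY_matSub_mulVec, h, projY_matSub_mulVec]

theorem mem_subLattice {z : Fin 2 → ℤ} :
    z ∈ P.subLattice ↔ ∃ x, P.matSub.mulVec (intToRat x) = intToRat z := by
  simp only [subLattice, LinearMap.mem_range, Matrix.mulVecLin_apply, matSub_mulVec_intToRat,
    intToRat_injective.eq_iff]

theorem card_quotient_subLattice :
    (Nat.card ((Fin 2 → ℤ) ⧸ P.subLattice) : ℤ) = |(P.M - 1).det| := by
  have hinj : Function.Injective (P.M - 1).mulVecLin := fun x y h => by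
    apply intToRat_injective
    apply P.matSub_mulVec_injective
    rw [matSub_mulVec_intToRat, matSub_mulVec_intToRat]
    exact congrArg intToRat h
  have h := Submodule.natAbs_det_equiv P.subLattice (LinearEquiv.ofInjective _ hinj)
  rw [← h, Int.natCast_natAbs]
  congr 1
  rw [← LinearMap.det_toLin']
  rfl

/-- The determinant is `(lam - 1) * (mu - 1)`, and neither eigenvalue is `1`. -/
theorem det_sub_one_ne_zero : (P.M - 1).det ≠ 0 := by
  have h : (P.M - 1).det = 1 - (P.M 0 0 + P.M 1 1) + P.M.det := by
    simp [Matrix.det_fin_two]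
    ring
  have h' : ((P.M - 1).det : ℝ) = (P.lam - 1) * (P.mu - 1) := by
    have := P.mu_eq
    have h2 : P.lam * P.mu = P.M.det := mul_div_cancel₀ _ P.lam_pos.ne'
    simp only [h, Int.cast_add, Int.cast_sub, Int.cast_one] at this ⊢
    linear_combination -h2 + this
  have h3 := mul_ne_zero (sub_pos.2 P.one_lt_lam).ne' P.mu_sub_one_ne_zero
  rw [← h'] at h3
  exact_mod_cast h3

instance finite_quotient_subLattice : Finite ((Fin 2 → ℤ) ⧸ P.subLattice) := by
  apply Nat.finite_of_card_ne_zero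
  have := P.card_quotient_subLattice
  have h := abs_pos.2 P.det_sub_one_ne_zero
  omega

/-- The base of the window of a tiling that is mapped to its translate by the vector coming
from `z`. -/
def fixedBase (s : Fin 2 → ℚ) (z : Fin 2 → ℤ) : ℝ :=
  (P.projY (ofRat s) + P.projY (ofInt z)) / (P.mu - 1)

theorem projY_eq_fixedBase_add_iff (s u r : Fin 2 → ℚ) (z : Fin 2 → ℤ) :
    P.projY (ofRat u) = P.fixedBase s z + P.projY (ofRat r) ↔
      P.matSub.mulVec u = s + P.matSub.mulVec r + intToRat z := by
  have hmu := P.mu_sub_one_ne_zero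
  rw [← P.projY_ofRat_injective.eq_iff, projY_matSub_mulVec, ofRat_add, ofRat_add, projY_add,
    projY_add, projY_matSub_mulVec, ← mul_right_inj' hmu, mul_add, fixedBase,
    mul_div_cancel₀ _ hmu, ofRat_intToRat, add_right_comm]

/-- Multiplying by `mu - 1` turns a shift of the base by `projY x` into a change of `z` by `(M -
I)x`. -/
theorem fixedBase_eq_add_iff (s : Fin 2 → ℚ) (z z' : Fin 2 → ℤ) :
    (∃ x : Fin 2 → ℤ, P.fixedBase s z' = P.fixedBase s z + P.projY (ofInt x)) ↔
      P.subLattice.mkQ z = P.subLattice.mkQ z' := by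
  have hmu := P.mu_sub_one_ne_zero
  rw [eq_comm, Submodule.mkQ_apply, Submodule.mkQ_apply, Submodule.Quotient.eq, mem_subLattice]
  refine exists_congr fun x => ?_
  rw [← P.projY_ofRat_injective.eq_iff, projY_matSub_mulVec, ofRat_intToRat, ofRat_intToRat,
    ofInt_sub, projY_sub, fixedBase, fixedBase, div_add' _ _ _ hmu, div_left_inj' hmu]
  constructor <;> intro h <;> linarith

/-- The residue classes of lattice vectors congruent to `-r` modulo `(M - I)ℤ²`. -/
def residueClass (r : Fin 2 → ℚ) : Set ((Fin 2 → ℤ) ⧸ P.subLattice) :=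
  {q | ∃ z x, P.subLattice.mkQ z = q ∧ P.matSub.mulVec (intToRat x) = r + intToRat z}

theorem residueClass_intToRat (y : Fin 2 → ℤ) :
    P.residueClass (intToRat y) = {P.subLattice.mkQ (-y)} := by
  ext q
  constructor
  · rintro ⟨z, x, rfl, h⟩
    rw [mem_singleton_iff, Submodule.mkQ_apply, Submodule.mkQ_apply, Submodule.Quotient.eq,
      mem_subLattice]
    refine ⟨x, h.trans ?_⟩
    ext i
    simp [intToRat, add_comm]
  · rintro rfl
    refine ⟨-y, 0, rfl, ?_⟩
    ext i
    fin_cases i <;> simp [intToRat, Matrix.mulVec, dotProduct]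

theorem residueClass_eq_empty {r : Fin 2 → ℚ} (h : r ∉ latticeZ2) : P.residueClass r = ∅ := by
  rw [eq_empty_iff_forall_notMem]
  rintro _ ⟨z, x, rfl, hx⟩
  rw [matSub_mulVec_intToRat, ← sub_eq_iff_eq_add] at hx
  refine h ⟨(P.M - 1).mulVec x - z, ?_⟩
  rw [← hx]
  ext i
  simp [intToRat]

/-- The residue classes giving rise to tilings with a singular window. -/
def singularClasses (s l : Fin 2 → ℚ) : Set ((Fin 2 → ℤ) ⧸ P.subLattice) :=
  P.residueClass s ∪ P.residueClass (s + P.matSub.mulVec l)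

theorem isSingular_fixedBase_iff (s l : Fin 2 → ℚ) (z : Fin 2 → ℤ) :
    P.IsSingular (P.projY (ofRat l)) (P.fixedBase s z) ↔
      P.subLattice.mkQ z ∈ P.singularClasses s l := by
  have h0 : ∀ x : Fin 2 → ℤ, P.projY (ofInt x) = P.fixedBase s z ↔
      P.matSub.mulVec (intToRat x) = s + intToRat z := by
    intro x
    have := P.projY_eq_fixedBase_add_iff s (intToRat x) 0 z
    rwa [P.projY_ofRat_eq_zero.2 rfl, add_zero, Matrix.mulVec_zero, add_zero,
      ofRat_intToRat] at this
  have h1 : ∀ x : Fin 2 → ℤ, P.projY (ofInt x) = P.fixedBase s z + P.projY (ofRat l) ↔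
      P.matSub.mulVec (intToRat x) = s + P.matSub.mulVec l + intToRat z := by
    intro x
    rw [← projY_eq_fixedBase_add_iff, ofRat_intToRat]
  constructor
  · rintro ⟨x, h | h⟩
    · exact Or.inl ⟨z, x, rfl, (h0 x).1 h⟩
    · exact Or.inr ⟨z, x, rfl, (h1 x).1 h⟩
  -- The condition defining `residueClass` does not depend on the representative of the class.
  · have hlift : ∀ (r : Fin 2 → ℚ), P.subLattice.mkQ z ∈ P.residueClass r →
        ∃ x, P.matSub.mulVec (intToRat x) = r + intToRat z := by
      rintro r ⟨z', x, hz, hx⟩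
      rw [eq_comm, Submodule.mkQ_apply, Submodule.mkQ_apply, Submodule.Quotient.eq,
        mem_subLattice] at hz
      obtain ⟨y, hy⟩ := hz
      refine ⟨x + y, ?_⟩
      have hadd : ∀ a b : Fin 2 → ℤ, intToRat (a + b) = intToRat a + intToRat b := by
        intro a b; ext i; simp [intToRat]
      rw [hadd, Matrix.mulVec_add, hx, hy, add_assoc, ← hadd, add_sub_cancel]
    rintro (h | h)
    · obtain ⟨x, hx⟩ := hlift _ h
      exact ⟨x, Or.inl ((h0 x).2 hx)⟩
    · obtain ⟨x, hx⟩ := hlift _ h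
      exact ⟨x, Or.inr ((h1 x).2 hx)⟩

theorem exists_eq_sub_matSub_iff (s l : Fin 2 → ℚ) :
    (∃ z ∈ latticeZ2, s = z - P.matSub.mulVec l) ↔ s + P.matSub.mulVec l ∈ latticeZ2 := by
  simp only [eq_sub_iff_add_eq, exists_eq_right']

theorem ncard_singularClasses_eq_zero {s l : Fin 2 → ℚ}
    (h : ¬ (s ∈ latticeZ2 ∨ s + P.matSub.mulVec l ∈ latticeZ2)) :
    (P.singularClasses s l).ncard = 0 := by
  rw [not_or] at h
  rw [singularClasses, P.residueClass_eq_empty h.1, P.residueClass_eq_empty h.2, union_empty,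
    ncard_empty]

/-- The representatives differ by `(M - I)l`, and `M - I` is injective on `ℚ²`. -/
theorem mkQ_neg_eq_iff {s l : Fin 2 → ℚ} {x y : Fin 2 → ℤ} (hx : intToRat x = s)
    (hy : intToRat y = s + P.matSub.mulVec l) :
    P.subLattice.mkQ (-x) = P.subLattice.mkQ (-y) ↔ l ∈ latticeZ2 := by
  rw [Submodule.mkQ_apply, Submodule.mkQ_apply, Submodule.Quotient.eq, mem_subLattice,
    mem_latticeZ2]
  have : intToRat (-x - -y) = P.matSub.mulVec l := by
    rw [← add_sub_cancel_left s (P.matSub.mulVec l), ← hy, ← hx]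
    ext i
    simp only [intToRat, Pi.sub_apply, Pi.neg_apply, Int.cast_sub, Int.cast_neg]
    ring
  simp only [this, P.matSub_mulVec_injective.eq_iff]

theorem ncard_singularClasses_eq_one {s l : Fin 2 → ℚ}
    (h : s ∈ latticeZ2 ∨ s + P.matSub.mulVec l ∈ latticeZ2)
    (h' : ¬ (s ∈ latticeZ2 ∧ s + P.matSub.mulVec l ∈ latticeZ2 ∧ l ∉ latticeZ2)) :
    (P.singularClasses s l).ncard = 1 := by
  rw [ncard_eq_one, singularClasses]
  by_cases h1 : s ∈ latticeZ2 <;> by_cases h2 : s + P.matSub.mulVec l ∈ latticeZ2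
  · have h3 : l ∈ latticeZ2 := by
      by_contra h3
      exact h' ⟨h1, h2, h3⟩
    obtain ⟨x, hx⟩ := mem_latticeZ2.1 h1
    obtain ⟨y, hy⟩ := mem_latticeZ2.1 h2
    rw [← hy, ← hx, residueClass_intToRat, residueClass_intToRat, (P.mkQ_neg_eq_iff hx hy).2 h3,
      union_self]
    exact ⟨_, rfl⟩
  · obtain ⟨x, hx⟩ := mem_latticeZ2.1 h1
    rw [P.residueClass_eq_empty h2, ← hx, residueClass_intToRat, union_empty]
    exact ⟨_, rfl⟩
  · obtain ⟨y, hy⟩ := mem_latticeZ2.1 h2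
    rw [P.residueClass_eq_empty h1, ← hy, residueClass_intToRat, empty_union]
    exact ⟨_, rfl⟩
  · exact (h.elim h1 h2).elim

theorem ncard_singularClasses_eq_two {s l : Fin 2 → ℚ}
    (h : s ∈ latticeZ2 ∧ s + P.matSub.mulVec l ∈ latticeZ2 ∧ l ∉ latticeZ2) :
    (P.singularClasses s l).ncard = 2 := by
  obtain ⟨h1, h2, h3⟩ := h
  obtain ⟨x, hx⟩ := mem_latticeZ2.1 h1
  obtain ⟨y, hy⟩ := mem_latticeZ2.1 h2
  rw [singularClasses, ← hy, ← hx, residueClass_intToRat, residueClass_intToRat, singleton_union,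
    ncard_pair]
  exact (P.mkQ_neg_eq_iff hx hy).not.2 h3

section Line

variable {A : Type*} {σ : SubstitutionRule A} {lab : Side → ℝ → A} {s l : Fin 2 → ℚ}

/-- The translation class of the tiling whose window is based at `fixedBase s z`. -/
def fixedClass (s l : Fin 2 → ℚ) (o : Side) (z : Fin 2 → ℤ) : Quotient translationSetoid :=
  ⟦P.vertices (P.projY (ofRat l)) o (P.fixedBase s z)⟧

theorem fixedClass_eq_iff (hl : 0 < P.projY (ofRat l)) (o o' : Side) (z z' : Fin 2 → ℤ) :
    P.fixedClass s l o z = P.fixedClass s l o' z' ↔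
      P.subLattice.mkQ z = P.subLattice.mkQ z' ∧
        (o = o' ∨ P.subLattice.mkQ z ∉ P.singularClasses s l) := by
  rw [fixedClass, fixedClass, Quotient.eq, ← isSingular_fixedBase_iff, ← fixedBase_eq_add_iff]
  exact P.translate_vertices_iff hl

theorem mem_fixedClasses (hl : 0 < P.projY (ofRat l))
    (hσ : P.IsSubstitutionRule σ lab (ofRat s) (ofRat l)) {C : Quotient translationSetoid} :
    C ∈ P.fixedClasses σ lab (ofRat l) ↔ ∃ o z, C = P.fixedClass s l o z ∧
      (P.M.det = 1 ∨ P.subLattice.mkQ z ∉ P.singularClasses s l) := by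
  have hmu := P.mu_sub_one_ne_zero
  have hbase : ∀ (y : ℝ) (x : Fin 2 → ℤ),
      P.mu * y - P.projY (ofRat s) = y + P.projY (ofInt x) ↔ y = P.fixedBase s x := by
    intro y x
    rw [fixedBase, eq_div_iff hmu]
    constructor <;> intro h <;> linarith
  -- The side is preserved exactly for `det M = 1`; otherwise the window has to be non-singular.
  have hfix : ∀ o t, (∃ c : ℝ, vert (σ.subst (P.tiling lab (ofRat l) o t)) =
      (fun x => x + c) '' vert (P.tiling lab (ofRat l) o t)) ↔
        (∃ x, P.projY t = P.fixedBase s x) ∧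
          (P.M.det = 1 ∨ ¬ P.IsSingular (P.projY (ofRat l)) (P.projY t)) := by
    intro o t
    rw [hσ.vert_subst_tiling, vert_tiling, P.translate_vertices_iff hl, eq_comm (a := o),
      turn_eq_self_iff]
    simp only [hbase]
  constructor
  · rintro ⟨_, ⟨o, t, rfl, h⟩, rfl⟩
    obtain ⟨⟨z, hz⟩, h⟩ := (hfix o t).1 h
    refine ⟨o, z, ?_, ?_⟩
    · rw [vert_tiling, hz]
      rfl
    · rwa [hz, isSingular_fixedBase_iff] at h
  · rintro ⟨o, z, rfl, h⟩
    refine ⟨_, ⟨o, ![0, P.fixedBase s z], rfl, (hfix _ _).2 ?_⟩, ?_⟩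
    · rw [projY_axis, isSingular_fixedBase_iff]
      exact ⟨⟨z, rfl⟩, h⟩
    · rw [vert_tiling, projY_axis]
      rfl

theorem fixedClasses_card (hl : 0 < P.projY (ofRat l))
    (hσ : P.IsSubstitutionRule σ lab (ofRat s) (ofRat l)) :
    (P.fixedClasses σ lab (ofRat l)).Finite ∧
      (P.M.det = 1 → ((P.fixedClasses σ lab (ofRat l)).ncard : ℤ) =
        |(P.M - 1).det| + (P.singularClasses s l).ncard) ∧
      (P.M.det = -1 → ((P.fixedClasses σ lab (ofRat l)).ncard : ℤ) =
        |(P.M - 1).det| - (P.singularClasses s l).ncard) := by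
  let f : Side → (Fin 2 → ℤ) ⧸ P.subLattice → Quotient translationSetoid :=
    fun o q => P.fixedClass s l o q.out
  have hout : ∀ q : (Fin 2 → ℤ) ⧸ P.subLattice, P.subLattice.mkQ q.out = q := Quotient.out_eq
  have hf : ∀ o q o' q', f o q = f o' q' ↔ q = q' ∧ (o = o' ∨ q ∉ P.singularClasses s l) := by
    intro o q o' q'
    simp only [f, P.fixedClass_eq_iff hl, hout]
  have hmem : ∀ C, C ∈ P.fixedClasses σ lab (ofRat l) ↔
      ∃ o q, C = f o q ∧ (P.M.det = 1 ∨ q ∉ P.singularClasses s l) := by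
    intro C
    rw [P.mem_fixedClasses hl hσ]
    refine exists_congr fun o => ⟨?_, ?_⟩
    · rintro ⟨z, rfl, h⟩
      refine ⟨P.subLattice.mkQ z, ?_, h⟩
      rw [P.fixedClass_eq_iff hl, hout]
      exact ⟨rfl, Or.inl rfl⟩
    · rintro ⟨q, rfl, h⟩
      exact ⟨q.out, rfl, by rwa [hout]⟩
  obtain ⟨h1, h2⟩ := ncard_range_of_two_sides hf
  refine ⟨?_, fun hdet => ?_, fun hdet => ?_⟩
  · refine ((finite_range (f .left)).union (finite_range (f .right))).subset fun C hC => ?_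
    obtain ⟨o, q, rfl, -⟩ := (hmem C).1 hC
    cases o
    exacts [Or.inl ⟨q, rfl⟩, Or.inr ⟨q, rfl⟩]
  · rw [← card_quotient_subLattice, ← Nat.cast_add, ← h1]
    congr 2
    ext C
    simp [hmem, hdet]
  · have hdet' : P.M.det ≠ 1 := by rw [hdet]; norm_num
    rw [← card_quotient_subLattice, ← h2, Nat.cast_add, add_sub_cancel_right]
    congr 2
    ext C
    simp [hmem, hdet']

end Line

end ProjectionStructure

end

theorem mainTheorem6 (P : ProjectionStructure) {A : Type*} [Finite A]
    (σ : SubstitutionRule A) (lab : Side → ℝ → A) (s l : Fin 2 → ℚ)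
    (hl : 0 < P.projY (ofRat l))
    (hσ : P.IsSubstitutionRule σ lab (ofRat s) (ofRat l)) :
    -- tilings of the line, up to translation
    ((P.fixedClasses σ lab (ofRat l)).Finite ∧
      (¬ (s ∈ latticeZ2 ∨ ∃ z ∈ latticeZ2, s = z - P.matSub.mulVec l) →
        ((P.fixedClasses σ lab (ofRat l)).ncard : ℤ) = |(P.M - 1).det|) ∧
      ((s ∈ latticeZ2 ∨ ∃ z ∈ latticeZ2, s = z - P.matSub.mulVec l) →
        ¬ (s ∈ latticeZ2 ∧ (∃ z ∈ latticeZ2, s = z - P.matSub.mulVec l) ∧ l ∉ latticeZ2) →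
        (P.M.det = 1 →
          ((P.fixedClasses σ lab (ofRat l)).ncard : ℤ) = |(P.M - 1).det| + 1) ∧
        (P.M.det = -1 →
          ((P.fixedClasses σ lab (ofRat l)).ncard : ℤ) = |(P.M - 1).det| - 1)) ∧
      ((s ∈ latticeZ2 ∧ (∃ z ∈ latticeZ2, s = z - P.matSub.mulVec l) ∧ l ∉ latticeZ2) →
        (P.M.det = 1 →
          ((P.fixedClasses σ lab (ofRat l)).ncard : ℤ) = |(P.M - 1).det| + 2) ∧
        (P.M.det = -1 →
          ((P.fixedClasses σ lab (ofRat l)).ncard : ℤ) = |(P.M - 1).det| - 2))) ∧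
    -- tilings of the half-line
    ((P.fixedHalfTilings σ lab (ofRat l)).Finite ∧
      (P.IWISingular (ofRat s) (ofRat l) ↔
        (∃ z ∈ latticeZ2, s = P.matSub.mulVec z) ∨
          ∃ z ∈ latticeZ2, s = P.matSub.mulVec (z - l)) ∧
      0 ∈ Set.Icc (P.iwiLeft (ofRat s)) (P.iwiRight (ofRat s) (ofRat l)) ∧
      (¬ P.IWISingular (ofRat s) (ofRat l) →
        (P.fixedHalfTilings σ lab (ofRat l)).ncard = 1) ∧
      ((P.iwiLeft (ofRat s) = 0 ∨ P.iwiRight (ofRat s) (ofRat l) = 0) →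
        P.M.det = 1 ∧ (P.fixedHalfTilings σ lab (ofRat l)).ncard = 1) ∧
      (P.IWISingular (ofRat s) (ofRat l) →
        0 ∈ Set.Ioo (P.iwiLeft (ofRat s)) (P.iwiRight (ofRat s) (ofRat l)) →
        ((∃ z, P.SingularPoint (ofRat s) (ofRat l) z ∧ 0 < P.projV (ofInt z)) →
          (P.M.det = 1 → (P.fixedHalfTilings σ lab (ofRat l)).ncard = 2) ∧
          (P.M.det = -1 → (P.fixedHalfTilings σ lab (ofRat l)).ncard = 0)) ∧
        ((∀ z, P.SingularPoint (ofRat s) (ofRat l) z → P.projV (ofInt z) < 0) →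
          (P.fixedHalfTilings σ lab (ofRat l)).ncard = 1))) := by
  obtain ⟨hfin, hpos, hneg⟩ := P.fixedClasses_card hl hσ
  refine ⟨⟨hfin, ?_, ?_, ?_⟩, (toFinite _).subset (ProjectionStructure.fixedHalfTilings_subset hσ hl),
    P.iwiSingular_iff s l, (ProjectionStructure.zero_mem_iwi hσ hl).1, fun hns => ?_,
    ProjectionStructure.fixedHalfTilings_of_iwi_end hσ hl, fun _ hint =>
      ⟨ProjectionStructure.ncard_fixedHalfTilings_of_ne hσ hl hint, ProjectionStructure.ncard_fixedHalfTilings_of_eq hσ hl hint⟩⟩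
  · rw [P.exists_eq_sub_matSub_iff]
    intro h
    rw [P.ncard_singularClasses_eq_zero h] at hpos hneg
    rcases P.det_eq_one_or_neg_one with hdet | hdet
    · simpa using hpos hdet
    · simpa using hneg hdet
  · rw [P.exists_eq_sub_matSub_iff]
    intro h h'
    rw [P.ncard_singularClasses_eq_one h h'] at hpos hneg
    exact ⟨hpos, hneg⟩
  · rw [P.exists_eq_sub_matSub_iff]
    intro h
    rw [P.ncard_singularClasses_eq_two h] at hpos hneg
    exact ⟨hpos, hneg⟩
  · obtain ⟨h0, h1⟩ := (ProjectionStructure.zero_mem_iwi hσ hl).1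
    -- The lattice point `0` projects to `0`, so in the non-singular case `0` is interior, and the
    -- condition on singular points is vacuous.
    refine ProjectionStructure.ncard_fixedHalfTilings_of_eq hσ hl ⟨lt_of_le_of_ne h0 ?_, lt_of_le_of_ne h1 ?_⟩
      fun z hz => (hns ⟨z, hz⟩).elim
    · intro h
      exact hns ⟨0, Or.inl (by rw [ofInt_zero, P.projY_zero, h])⟩
    · intro h
      exact hns ⟨0, Or.inr (by rw [ofInt_zero, P.projY_zero, h])⟩
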